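/- A regular category is a category with finite limits in which every kernel pair has a coequalizer and regular epimorphisms are stable under pullback. A category $\mathcal C$ with pullbacks is called protomodular if, for every pullback square with sides $g\colon D\to E$, $q\colon D\to A$, $p\colon E\to B$, $f\colon A\to B$ (so $pg=fq$) in which $p$ is a split epimorphism with section $s\colon B\to E$ (so $ps=1_B$), the pair $(g,s)$ is jointly strongly epimorphic, i.e. jointly epimorphic and such that for every monomorphism $m\colon U\to V$ and all $a\colon D\to U$, $b\colon B\to U$, $h\colon E\to V$ with $ma=hg$ and $mb=hs$ there is $d\colon E\to U$ with $md=h$. For a regular category $\mathcal X$, let $\mathrm{Rel}(\mathcal X)$ be the bicategory of relations in $\mathcal X$: its objects are those of $\mathcal X$, and a morphism from $X$ to $Y$ is a subobject of $X\times Y$. The exact completion $\mathcal X_{\mathrm{ex/reg}}$ of $\mathcal X$ (as a regular category) is the category of maps in the bicategory obtained from $\mathrm{Rel}(\mathcal X)$ by freely splitting the equivalence relations. Explicitly, its objects are the pairs $(X,E)$ with $E$ an equivalence relation on an object $X$ of $\mathcal X$; a morphism $(X,E)\to(Y,F)$ is a relation $R$ from $X$ to $Y$ with $RE=R=FR$,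 $E\le R^\circ R$ and $RR^\circ\le F$; composition is composition of relations, and the identity of $(X,E)$ is $E$. **Proposition.** If $\mathcal X$ is a regular protomodular category, then its exact completion $\mathcal X_{\mathrm{ex/reg}}$ is also protomodular (in particular, it has pullbacks). -/

import Mathlib

open CategoryTheory CategoryTheory.Limits

universe v u

/-! ## Protomodular categories -/

/-- A pair of morphisms `g : D ⟶ E`, `s : B ⟶ E` with common codomain is jointly strongly
epimorphic when it is jointly epimorphic and has the (joint) left lifting property with respect to
every monomorphism `m : U ⟶ V`.  (The lift is automatically unique, and automatically satisfies
`g ≫ d = a` and `s ≫ d = b`, because `m` is monic.) -/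
structure JointlyStrongEpi {C : Type u} [Category.{v} C] {D B E : C} (g : D ⟶ E) (s : B ⟶ E) :
    Prop where
  hom_ext : ∀ ⦃V : C⦄ (h k : E ⟶ V), g ≫ h = g ≫ k → s ≫ h = s ≫ k → h = k
  exists_lift : ∀ ⦃U V : C⦄ (m : U ⟶ V) [Mono m] (a : D ⟶ U) (b : B ⟶ U) (h : E ⟶ V),
    a ≫ m = g ≫ h → b ≫ m = s ≫ h → ∃ d : E ⟶ U, d ≫ m = h

/-- A category is protomodular if it has pullbacks and, for every pullback square
```
  D --g--> E
  |q       |p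
  v        v
  A --f--> B
```
in which `p` is a split epimorphism with section `s : B ⟶ E`, the pair `(g, s)` is jointly strongly
epimorphic. -/
structure Protomodular (C : Type u) [Category.{v} C] : Prop where
  hasPullbacks : HasPullbacks C
  jointlyStrongEpi : ∀ ⦃D E A B : C⦄ (g : D ⟶ E) (q : D ⟶ A) (p : E ⟶ B) (f : A ⟶ B) (s : B ⟶ E),
    IsPullback g q p f → s ≫ p = 𝟙 B → JointlyStrongEpi g s

/-! ## The calculus of relations in a regular category -/

/-- A relation from `X` to `Y` is a subobject of `X ⨯ Y`. -/
abbrev InternalRel {C : Type u} [Category.{v} C] [Regular C] (X Y : C) : Type (max u v) :=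
  Subobject (X ⨯ Y)

namespace InternalRel

noncomputable section

variable {C : Type u} [Category.{v} C] [Regular C] {X Y Z W T : C}

/-- The first leg of a relation. -/
def fst (R : InternalRel X Y) : (R : C) ⟶ X := R.arrow ≫ prod.fst

/-- The second leg of a relation. -/
def snd (R : InternalRel X Y) : (R : C) ⟶ Y := R.arrow ≫ prod.snd

/-- The generalized elements `x : T ⟶ X` and `y : T ⟶ Y` are related by `R`. -/
def Holds (R : InternalRel X Y) (x : T ⟶ X) (y : T ⟶ Y) : Prop := R.Factors (prod.lift x y)

variable (X) in
/-- The identity relation on `X`, given by the diagonal `X ⟶ X ⨯ X`. -/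
def one : InternalRel X X := Subobject.mk (diag X)

/-- The opposite relation. -/
def opp (R : InternalRel X Y) : InternalRel Y X :=
  (Subobject.pullback (prod.lift prod.snd prod.fst)).obj R

/-- Composition of relations, in diagrammatic order (first `R`, then `S`): the image in `X ⨯ Z` of
the pullback of the second leg of `R` along the first leg of `S`. -/
def comp (R : InternalRel X Y) (S : InternalRel Y Z) : InternalRel X Z :=
  imageSubobject (prod.lift (pullback.fst R.snd S.fst ≫ R.fst) (pullback.snd R.snd S.fst ≫ S.snd))

/-- A binary relation is an equivalence relation if it is reflexive, symmetric and transitive. -/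
structure IsEquivalence (R : InternalRel X X) : Prop where
  refl : one X ≤ R
  symm : R ≤ R.opp
  trans : R.comp R ≤ R

/-! ### Description of the operations by generalized elements -/

theorem lift_fst_snd (R : InternalRel X Y) (k : T ⟶ (R : C)) :
    prod.lift (k ≫ R.fst) (k ≫ R.snd) = k ≫ R.arrow := by
  ext
  · rw [prod.lift_fst, Category.assoc, fst]
  · rw [prod.lift_snd, Category.assoc, snd]

theorem holds_iff_exists (R : InternalRel X Y) (x : T ⟶ X) (y : T ⟶ Y) :
    R.Holds x y ↔ ∃ k : T ⟶ (R : C), k ≫ R.fst = x ∧ k ≫ R.snd = y := by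
  constructor
  · intro h
    have h' : Subobject.Factors R (prod.lift x y) := h
    have e := Subobject.factorThru_arrow R _ h'
    refine ⟨R.factorThru _ h', ?_, ?_⟩
    · rw [fst, ← Category.assoc, e, prod.lift_fst]
    · rw [snd, ← Category.assoc, e, prod.lift_snd]
  · rintro ⟨k, rfl, rfl⟩
    rw [Holds, lift_fst_snd]
    exact Subobject.factors_comp_arrow k

theorem holds_legs (R : InternalRel X Y) : R.Holds R.fst R.snd :=
  (R.holds_iff_exists _ _).2 ⟨𝟙 _, Category.id_comp _, Category.id_comp _⟩

theorem Holds.precomp {R : InternalRel X Y} {x : T ⟶ X} {y : T ⟶ Y} (h : R.Holds x y)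
    (e : W ⟶ T) : R.Holds (e ≫ x) (e ≫ y) := by
  obtain ⟨k, rfl, rfl⟩ := (R.holds_iff_exists _ _).1 h
  exact (R.holds_iff_exists _ _).2 ⟨e ≫ k, Category.assoc _ _ _, Category.assoc _ _ _⟩

theorem le_iff_holds {R S : InternalRel X Y} :
    R ≤ S ↔ ∀ ⦃T : C⦄ (x : T ⟶ X) (y : T ⟶ Y), R.Holds x y → S.Holds x y := by
  constructor
  · intro h T x y hR
    exact Subobject.factors_of_le _ h hR
  · intro h
    apply Subobject.le_of_factors
    have := h _ _ ((R.holds_legs).precomp (𝟙 _))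
    rwa [Holds, lift_fst_snd, Category.id_comp] at this

theorem ext_holds {R S : InternalRel X Y}
    (h : ∀ ⦃T : C⦄ (x : T ⟶ X) (y : T ⟶ Y), R.Holds x y ↔ S.Holds x y) : R = S :=
  le_antisymm (le_iff_holds.2 fun _ x y => (h x y).1) (le_iff_holds.2 fun _ x y => (h x y).2)

/-- `Holds` is local for regular epimorphisms. -/
theorem Holds.descend {R : InternalRel X Y} {x : T ⟶ X} {y : T ⟶ Y} (e : W ⟶ T) [IsRegularEpi e]
    (h : R.Holds (e ≫ x) (e ≫ y)) : R.Holds x y := by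
  obtain ⟨k, h₁, h₂⟩ := (R.holds_iff_exists _ _).1 h
  have sq : CommSq k e R.arrow (prod.lift x y) :=
    ⟨by rw [← lift_fst_snd, h₁, h₂, prod.comp_lift]⟩
  exact (Subobject.factors_iff _ _).2 ⟨sq.lift, sq.fac_right⟩

theorem holds_one_iff (x y : T ⟶ X) : (one X).Holds x y ↔ x = y := by
  rw [Holds, one, Subobject.mk_factors_iff]
  constructor
  · intro h
    obtain ⟨k, hk⟩ : ∃ k : T ⟶ X, k ≫ prod.lift (𝟙 X) (𝟙 X) = prod.lift x y := h
    rw [prod.comp_lift, Category.comp_id] at hk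
    have h₁ : k = x := by rw [← prod.lift_fst k k, hk, prod.lift_fst]
    have h₂ : k = y := by rw [← prod.lift_snd k k, hk, prod.lift_snd]
    exact h₁.symm.trans h₂
  · rintro rfl
    refine ⟨x, ?_⟩
    change x ≫ prod.lift (𝟙 X) (𝟙 X) = _
    rw [prod.comp_lift, Category.comp_id]

theorem holds_opp_iff (R : InternalRel X Y) (y : T ⟶ Y) (x : T ⟶ X) :
    R.opp.Holds y x ↔ R.Holds x y := by
  rw [Holds, opp, pullback_factors_iff, Holds, prod.comp_lift, prod.lift_fst, prod.lift_snd]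

theorem holds_comp_iff (R : InternalRel X Y) (S : InternalRel Y Z) (x : T ⟶ X) (z : T ⟶ Z) :
    (R.comp S).Holds x z ↔ ∃ (T' : C) (e : T' ⟶ T) (_ : IsRegularEpi e) (y : T' ⟶ Y),
      R.Holds (e ≫ x) y ∧ S.Holds y (e ≫ z) := by
  set a := pullback.fst R.snd S.fst with ha
  set b := pullback.snd R.snd S.fst with hb
  set φ := prod.lift (a ≫ R.fst) (b ≫ S.snd) with hφ
  have hab : a ≫ R.snd = b ≫ S.fst := pullback.condition
  constructor
  · intro h
    obtain ⟨k, hk⟩ : ∃ k : T ⟶ image φ, k ≫ image.ι φ = prod.lift x z :=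
      (Subobject.mk_factors_iff (image.ι φ) _).1 h
    have : IsRegularEpi (factorThruImage φ) := inferInstance
    set l := pullback.fst (factorThruImage φ) k with hl
    set e := pullback.snd (factorThruImage φ) k with he
    have hle : l ≫ factorThruImage φ = e ≫ k := pullback.condition
    have key : prod.lift (l ≫ a ≫ R.fst) (l ≫ b ≫ S.snd) = prod.lift (e ≫ x) (e ≫ z) := by
      rw [← prod.comp_lift, ← prod.comp_lift, ← hk, ← hφ, ← Category.assoc, ← hle, Category.assoc,
        image.fac]
    have h₁ := congrArg (· ≫ prod.fst) key
    have h₂ := congrArg (· ≫ prod.snd) key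
    simp only [prod.lift_fst, prod.lift_snd] at h₁ h₂
    refine ⟨_, e, inferInstance, l ≫ a ≫ R.snd, ?_, ?_⟩
    · rw [← h₁]
      exact (R.holds_legs.precomp a).precomp l
    · rw [← h₂, hab]
      exact (S.holds_legs.precomp b).precomp l
  · rintro ⟨T', e, he, y, hR, hS⟩
    obtain ⟨k, hk₁, hk₂⟩ := (R.holds_iff_exists _ _).1 hR
    obtain ⟨l, hl₁, hl₂⟩ := (S.holds_iff_exists _ _).1 hS
    apply Holds.descend e
    have hw : k ≫ R.snd = l ≫ S.fst := hk₂.trans hl₁.symm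
    have hka : pullback.lift k l hw ≫ a = k := pullback.lift_fst _ _ _
    have hlb : pullback.lift k l hw ≫ b = l := pullback.lift_snd _ _ _
    refine (Subobject.mk_factors_iff (image.ι φ) _).2 ⟨pullback.lift k l hw ≫ factorThruImage φ, ?_⟩
    change (pullback.lift k l hw ≫ factorThruImage φ) ≫ image.ι φ = _
    rw [Category.assoc, image.fac, hφ, prod.comp_lift, ← Category.assoc, hka, ← Category.assoc, hlb,
      hk₁, hl₂]

/-! ### Algebraic laws -/

theorem comp_holds {R : InternalRel X Y} {S : InternalRel Y Z} {x : T ⟶ X} {y : T ⟶ Y} {z : T ⟶ Z}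
    (hR : R.Holds x y) (hS : S.Holds y z) : (R.comp S).Holds x z :=
  (holds_comp_iff _ _ _ _).2 ⟨T, 𝟙 T, inferInstance, y, by simpa using hR, by simpa using hS⟩

theorem comp_mono {R R' : InternalRel X Y} {S S' : InternalRel Y Z} (hR : R ≤ R') (hS : S ≤ S') :
    R.comp S ≤ R'.comp S' := by
  refine le_iff_holds.2 fun T x z h => ?_
  obtain ⟨T', e, he, y, h₁, h₂⟩ := (holds_comp_iff _ _ _ _).1 h
  exact (holds_comp_iff _ _ _ _).2
    ⟨T', e, he, y, le_iff_holds.1 hR _ _ h₁, le_iff_holds.1 hS _ _ h₂⟩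

theorem comp_assoc (R : InternalRel X Y) (S : InternalRel Y Z) (Q : InternalRel Z W) :
    (R.comp S).comp Q = R.comp (S.comp Q) := by
  apply le_antisymm
  · refine le_iff_holds.2 fun T x w h => ?_
    obtain ⟨T', e, he, z, h₁, h₂⟩ := (holds_comp_iff _ _ _ _).1 h
    obtain ⟨T'', e', he', y, h₃, h₄⟩ := (holds_comp_iff _ _ _ _).1 h₁
    apply Holds.descend e
    apply Holds.descend e'
    exact comp_holds h₃ (comp_holds h₄ (h₂.precomp e'))
  · refine le_iff_holds.2 fun T x w h => ?_
    obtain ⟨T', e, he, y, h₁, h₂⟩ := (holds_comp_iff _ _ _ _).1 h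
    obtain ⟨T'', e', he', z, h₃, h₄⟩ := (holds_comp_iff _ _ _ _).1 h₂
    apply Holds.descend e
    apply Holds.descend e'
    exact comp_holds (comp_holds (h₁.precomp e') h₃) h₄

theorem one_comp (R : InternalRel X Y) : (one X).comp R = R := by
  apply le_antisymm
  · refine le_iff_holds.2 fun T x y h => ?_
    obtain ⟨T', e, he, x', h₁, h₂⟩ := (holds_comp_iff _ _ _ _).1 h
    obtain rfl := (holds_one_iff _ _).1 h₁
    exact h₂.descend e
  · exact le_iff_holds.2 fun _ _ _ h => comp_holds ((holds_one_iff _ _).2 rfl) h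

theorem opp_opp (R : InternalRel X Y) : R.opp.opp = R :=
  ext_holds fun _ _ _ => by rw [holds_opp_iff, holds_opp_iff]

theorem opp_mono {R S : InternalRel X Y} (h : R ≤ S) : R.opp ≤ S.opp :=
  le_iff_holds.2 fun _ _ _ hR =>
    (holds_opp_iff _ _ _).2 (le_iff_holds.1 h _ _ ((holds_opp_iff _ _ _).1 hR))

theorem opp_comp (R : InternalRel X Y) (S : InternalRel Y Z) :
    (R.comp S).opp = S.opp.comp R.opp := by
  refine ext_holds fun T _ _ => ?_
  simp only [holds_opp_iff, holds_comp_iff]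
  constructor
  · rintro ⟨T', e, he, y, h₁, h₂⟩
    exact ⟨T', e, he, y, h₂, h₁⟩
  · rintro ⟨T', e, he, y, h₁, h₂⟩
    exact ⟨T', e, he, y, h₂, h₁⟩

theorem IsEquivalence.opp_eq {R : InternalRel X X} (h : R.IsEquivalence) : R.opp = R :=
  le_antisymm (by simpa [opp_opp] using opp_mono h.symm) h.symm

theorem IsEquivalence.comp_self {R : InternalRel X X} (h : R.IsEquivalence) : R.comp R = R := by
  apply le_antisymm h.trans
  conv_lhs => rw [← one_comp R]
  exact comp_mono h.refl le_rfl

end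

end InternalRel

/-! ## The exact completion of a regular category

Equivalence relations are idempotents in the bicategory of relations of `C`.  Splitting them freely
gives a new bicategory of relations, whose objects are the pairs `(X, E)` with `E` an equivalence
relation on `X`, and whose morphisms `(X, E) ⟶ (Y, F)` are the relations `R` from `X` to `Y` with
`R ∘ E = R` and `F ∘ R = R`; the identity of `(X, E)` is `E`.  The exact completion is the category
of maps in it. -/

/-- Objects of the exact completion of the regular category `C`: objects of `C` equipped with an
equivalence relation. -/
structure ExReg (C : Type u) [Category.{v} C] [Regular C] : Type (max u v) where
  /-- the underlying object -/
  carrier : C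
  /-- the equivalence relation to be split -/
  rel : InternalRel carrier carrier
  isEquivalence : rel.IsEquivalence

namespace ExReg

variable {C : Type u} [Category.{v} C] [Regular C]

/-- Morphisms `A ⟶ B` of the exact completion: the morphisms `A ⟶ B` of the free splitting of the
equivalence relations which are maps there, that is, which are left adjoint to their opposite. -/
@[ext]
structure Hom (A B : ExReg C) : Type (max u v) where
  /-- the underlying relation -/
  graph : InternalRel A.carrier B.carrier
  rel_comp : A.rel.comp graph = graph
  comp_rel : graph.comp B.rel = graph
  /-- the unit of the adjunction (totality) -/
  unit : A.rel ≤ graph.comp graph.opp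
  /-- the counit of the adjunction (single-valuedness) -/
  counit : graph.opp.comp graph ≤ B.rel

open InternalRel

/-- In the free splitting of the equivalence relations, a morphism is left adjoint to its opposite
as soon as it has any right adjoint at all; so the morphisms in `Hom` are exactly the maps. -/
theorem exists_rightAdjoint_iff {A B : ExReg C} (R : InternalRel A.carrier B.carrier)
    (h₁ : A.rel.comp R = R) (h₂ : R.comp B.rel = R) :
    (∃ S : InternalRel B.carrier A.carrier, B.rel.comp S = S ∧ S.comp A.rel = S ∧
      A.rel ≤ R.comp S ∧ S.comp R ≤ B.rel) ↔
    (A.rel ≤ R.comp R.opp ∧ R.opp.comp R ≤ B.rel) := by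
  constructor
  · rintro ⟨S, hS₁, hS₂, hu, hc⟩
    have hrefl : ∀ ⦃T : C⦄ (x : T ⟶ A.carrier), A.rel.Holds x x := fun T x =>
      le_iff_holds.1 A.isEquivalence.refl _ _ ((holds_one_iff _ _).2 rfl)
    have key : S = R.opp := by
      refine ext_holds fun T y x => ?_
      rw [holds_opp_iff]
      obtain ⟨T', e, he, y', h₃, h₄⟩ := (holds_comp_iff _ _ _ _).1 (le_iff_holds.1 hu _ _ (hrefl x))
      constructor
      · intro h
        apply Holds.descend e
        rw [← h₂]
        have := le_iff_holds.1 hc _ _ (comp_holds (h.precomp e) h₃)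
        rw [← B.isEquivalence.opp_eq, holds_opp_iff] at this
        exact comp_holds h₃ this
      · intro h
        apply Holds.descend e
        rw [← hS₁]
        have := le_iff_holds.1 hc _ _ (comp_holds h₄ (h.precomp e))
        rw [← B.isEquivalence.opp_eq, holds_opp_iff] at this
        exact comp_holds this h₄
    subst key
    exact ⟨hu, hc⟩
  · rintro ⟨hu, hc⟩
    refine ⟨R.opp, ?_, ?_, hu, hc⟩
    · rw [← B.isEquivalence.opp_eq, ← opp_comp, h₂]
    · rw [← A.isEquivalence.opp_eq, ← opp_comp, h₁]

/-- The identity of `(X, E)` is `E`. -/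
def Hom.id (A : ExReg C) : Hom A A where
  graph := A.rel
  rel_comp := A.isEquivalence.comp_self
  comp_rel := A.isEquivalence.comp_self
  unit := by rw [A.isEquivalence.opp_eq, A.isEquivalence.comp_self]
  counit := by rw [A.isEquivalence.opp_eq, A.isEquivalence.comp_self]

/-- Composition is composition of relations. -/
noncomputable def Hom.comp {A B D : ExReg C} (R : Hom A B) (S : Hom B D) : Hom A D where
  graph := R.graph.comp S.graph
  rel_comp := by rw [← comp_assoc, R.rel_comp]
  comp_rel := by rw [comp_assoc, S.comp_rel]
  unit := by
    have h : R.graph.comp R.graph.opp ≤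
        (R.graph.comp (S.graph.comp S.graph.opp)).comp R.graph.opp := by
      conv_lhs => rw [← R.comp_rel, R.comp_rel, ← R.comp_rel]
      exact comp_mono (comp_mono le_rfl S.unit) (opp_mono R.comp_rel.le)
    rw [opp_comp]
    refine R.unit.trans (h.trans (le_of_eq ?_))
    simp only [comp_assoc]
  counit := by
    have h : (S.graph.opp.comp (R.graph.opp.comp R.graph)).comp S.graph ≤
        (S.graph.opp.comp B.rel).comp S.graph :=
      comp_mono (comp_mono le_rfl R.counit) le_rfl
    have h' : (S.graph.opp.comp B.rel).comp S.graph = S.graph.opp.comp S.graph := by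
      rw [comp_assoc, S.rel_comp]
    rw [opp_comp]
    refine (le_of_eq ?_).trans ((h.trans h'.le).trans S.counit)
    simp only [comp_assoc]

/-- The exact completion (as a regular category) of the regular category `C`. -/
noncomputable instance : Category.{max u v} (ExReg C) where
  Hom := Hom
  id := Hom.id
  comp := Hom.comp
  id_comp f := Hom.ext f.rel_comp
  comp_id f := Hom.ext f.comp_rel
  assoc f g h := Hom.ext (comp_assoc f.graph g.graph h.graph)

end ExReg

/-! An object `(X, E)` is treated as a set `X` with equality `E`: its elements are generalized
elements `T ⟶ X`, existence means existence after a regular epimorphic cover of `T`, and a morphism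
is a relation that is total and single-valued up to `E`. Pullbacks are then computed as for sets.

For protomodularity, take a pullback of a split epimorphism `p` with section `s` in the completion.
In general `p` and `s` are only relations in `C`, but a genuine split epimorphism of `C` arises by
replacing `p`, `f` and the base by their graphs and pulling back to the graph of `s`, a cover of the
base over which `s` becomes a morphism. The total space of this split epimorphism covers the carrier
of `E`. Protomodularity of `C` then shows that a subobject of that carrier containing all values of
`g` and of `s` is everything (`factors_of_protomodular`).

Both halves of joint strong epimorphy reduce to this: apply it to the subobject where two morphisms
agree, and to the subobject of elements whose image lies in a given monomorphism. -/

/-- Membership in a subobject is local for regular epimorphisms. -/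
theorem CategoryTheory.Subobject.factors_of_regularEpi_comp {C : Type u} [Category.{v} C]
    {X T T' : C} (N : Subobject X) (e : T' ⟶ T) [IsRegularEpi e] {x : T ⟶ X}
    (h : N.Factors (e ≫ x)) : N.Factors x := by
  have sq : CommSq (N.factorThru _ h) e N.arrow x := ⟨Subobject.factorThru_arrow _ _ _⟩
  exact (Subobject.factors_iff _ _).2 ⟨sq.lift, sq.fac_right⟩

/-! ### Equivalence relations and domains in terms of generalized elements. -/

namespace InternalRel

variable {C : Type u} [Category.{v} C] [Regular C] {X Y X' Y' T : C}

/-- The inverse image of a relation along a pair of morphisms. -/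
noncomputable def inverseImage (R : InternalRel X Y) (a : X' ⟶ X) (b : Y' ⟶ Y) :
    InternalRel X' Y' :=
  (Subobject.pullback (prod.map a b)).obj R

theorem holds_inverseImage_iff (R : InternalRel X Y) (a : X' ⟶ X) (b : Y' ⟶ Y)
    (x : T ⟶ X') (y : T ⟶ Y') :
    (R.inverseImage a b).Holds x y ↔ R.Holds (x ≫ a) (y ≫ b) := by
  rw [Holds, inverseImage, pullback_factors_iff, Holds, prod.lift_map]

theorem holds_inf_iff (R S : InternalRel X Y) (x : T ⟶ X) (y : T ⟶ Y) :
    (R ⊓ S).Holds x y ↔ R.Holds x y ∧ S.Holds x y :=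
  Subobject.inf_factors _

theorem IsEquivalence.holds_refl {R : InternalRel X X} (h : R.IsEquivalence) (x : T ⟶ X) :
    R.Holds x x :=
  le_iff_holds.1 h.refl _ _ ((holds_one_iff _ _).2 rfl)

theorem IsEquivalence.holds_symm {R : InternalRel X X} (h : R.IsEquivalence) {x y : T ⟶ X}
    (hxy : R.Holds x y) : R.Holds y x :=
  (holds_opp_iff _ _ _).1 (le_iff_holds.1 h.symm _ _ hxy)

theorem IsEquivalence.holds_trans {R : InternalRel X X} (h : R.IsEquivalence) {x y z : T ⟶ X}
    (hxy : R.Holds x y) (hyz : R.Holds y z) : R.Holds x z :=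
  le_iff_holds.1 h.trans _ _ (comp_holds hxy hyz)

/-- The cover hidden in a composite of relations can be discarded, since `Holds` descends along
regular epimorphisms; so transitivity need only be tested on an actual middle element. -/
theorem IsEquivalence.of_holds {R : InternalRel X X}
    (refl : ∀ ⦃T : C⦄ (x : T ⟶ X), R.Holds x x)
    (symm : ∀ ⦃T : C⦄ (x y : T ⟶ X), R.Holds x y → R.Holds y x)
    (trans : ∀ ⦃T : C⦄ (x y z : T ⟶ X), R.Holds x y → R.Holds y z → R.Holds x z) :
    R.IsEquivalence where
  refl := le_iff_holds.2 fun T x y h => by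
    obtain rfl := (holds_one_iff _ _).1 h
    exact refl x
  symm := le_iff_holds.2 fun T x y h => (holds_opp_iff _ _ _).2 (symm _ _ h)
  trans := le_iff_holds.2 fun T x z h => by
    obtain ⟨T', e, he, y, h₁, h₂⟩ := (holds_comp_iff _ _ _ _).1 h
    exact (trans _ _ _ h₁ h₂).descend e

theorem isEquivalence_one (X : C) : (one X).IsEquivalence :=
  .of_holds (fun _ _ => (holds_one_iff _ _).2 rfl)
    (fun _ _ _ h => (holds_one_iff _ _).2 ((holds_one_iff _ _).1 h).symm)
    (fun _ _ _ _ h h' =>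
      (holds_one_iff _ _).2 (((holds_one_iff _ _).1 h).trans ((holds_one_iff _ _).1 h')))

theorem IsEquivalence.inverseImage {R : InternalRel X X} (h : R.IsEquivalence) (a : X' ⟶ X) :
    (R.inverseImage a a).IsEquivalence := by
  refine .of_holds ?_ ?_ ?_ <;> simp only [holds_inverseImage_iff]
  · exact fun T x => h.holds_refl _
  · exact fun T x y => h.holds_symm
  · exact fun T x y z => h.holds_trans

theorem IsEquivalence.inf {R S : InternalRel X X} (hR : R.IsEquivalence) (hS : S.IsEquivalence) :
    (R ⊓ S).IsEquivalence := by
  refine .of_holds ?_ ?_ ?_ <;> simp only [holds_inf_iff]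
  · exact fun T x => ⟨hR.holds_refl _, hS.holds_refl _⟩
  · exact fun T x y h => ⟨hR.holds_symm h.1, hS.holds_symm h.2⟩
  · exact fun T x y z h h' => ⟨hR.holds_trans h.1 h'.1, hS.holds_trans h.2 h'.2⟩

/-- The domain of a relation. -/
noncomputable def dom (R : InternalRel X Y) : Subobject X := imageSubobject R.fst

theorem dom_factors_of_holds {R : InternalRel X Y} {x : T ⟶ X} {y : T ⟶ Y} (h : R.Holds x y) :
    R.dom.Factors x := by
  obtain ⟨k, rfl, -⟩ := (R.holds_iff_exists _ _).1 h
  refine (Subobject.mk_factors_iff (image.ι R.fst) _).2 ⟨k ≫ factorThruImage R.fst, ?_⟩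
  change (k ≫ factorThruImage R.fst) ≫ image.ι R.fst = _
  rw [Category.assoc, image.fac]

/-- The cover is the pullback along `x` of the regular epimorphism from `R` onto its image. -/
theorem exists_holds_of_dom_factors {R : InternalRel X Y} {x : T ⟶ X} (h : R.dom.Factors x) :
    ∃ (T' : C) (e : T' ⟶ T) (_ : IsRegularEpi e) (y : T' ⟶ Y), R.Holds (e ≫ x) y := by
  obtain ⟨k, rfl⟩ : ∃ k : T ⟶ image R.fst, k ≫ image.ι R.fst = x :=
    (Subobject.mk_factors_iff (image.ι R.fst) _).1 h
  refine ⟨_, pullback.snd (factorThruImage R.fst) k, inferInstance,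
    pullback.fst (factorThruImage R.fst) k ≫ R.snd, ?_⟩
  rw [← Category.assoc, ← pullback.condition, Category.assoc, image.fac]
  exact R.holds_legs.precomp _

end InternalRel

/-! ### Morphisms of the completion as functional relations. -/

namespace ExReg

open InternalRel

variable {C : Type u} [Category.{v} C] [Regular C] {A B D : ExReg C} {T : C}

theorem holds_of_rel_left (f : A ⟶ B) {x x' : T ⟶ A.carrier} {y : T ⟶ B.carrier}
    (hx : A.rel.Holds x x') (h : f.graph.Holds x' y) : f.graph.Holds x y := by
  rw [← f.rel_comp]
  exact comp_holds hx h

theorem holds_of_rel_right (f : A ⟶ B) {x : T ⟶ A.carrier} {y y' : T ⟶ B.carrier}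
    (h : f.graph.Holds x y) (hy : B.rel.Holds y y') : f.graph.Holds x y' := by
  rw [← f.comp_rel]
  exact comp_holds h hy

/-- The unit, applied to the related pair `(x, x)`, produces a value of `f` as the middle element.
-/
theorem exists_holds (f : A ⟶ B) (x : T ⟶ A.carrier) :
    ∃ (T' : C) (e : T' ⟶ T) (_ : IsRegularEpi e) (y : T' ⟶ B.carrier),
      f.graph.Holds (e ≫ x) y := by
  obtain ⟨T', e, he, y, h, -⟩ := (holds_comp_iff _ _ _ _).1
    (le_iff_holds.1 f.unit _ _ (A.isEquivalence.holds_refl x))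
  exact ⟨T', e, he, y, h⟩

theorem rel_of_holds (f : A ⟶ B) {x : T ⟶ A.carrier} {y y' : T ⟶ B.carrier}
    (h : f.graph.Holds x y) (h' : f.graph.Holds x y') : B.rel.Holds y y' :=
  le_iff_holds.1 f.counit _ _ (comp_holds ((holds_opp_iff _ _ _).2 h) h')

theorem id_graph (A : ExReg C) : (𝟙 A : A ⟶ A).graph = A.rel := rfl

theorem holds_comp (f : A ⟶ B) (g : B ⟶ D) {x : T ⟶ A.carrier} {y : T ⟶ B.carrier}
    {z : T ⟶ D.carrier} (hf : f.graph.Holds x y) (hg : g.graph.Holds y z) :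
    (f ≫ g).graph.Holds x z :=
  comp_holds hf hg

/-- If `x` is sent to `z` by `f ≫ g` and to `y` by `f`, then `y` is sent to `z` by `g`. -/
theorem holds_right_of_comp (f : A ⟶ B) (g : B ⟶ D) {x : T ⟶ A.carrier} {y : T ⟶ B.carrier}
    {z : T ⟶ D.carrier} (h : (f ≫ g).graph.Holds x z) (hf : f.graph.Holds x y) :
    g.graph.Holds y z := by
  obtain ⟨T', e, he, y', h₁, h₂⟩ := (holds_comp_iff _ _ _ _).1 h
  exact (holds_of_rel_left g (rel_of_holds f (hf.precomp e) h₁) h₂).descend e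

/-- Morphisms are equal as soon as they locally have a common value at every element. -/
theorem hom_ext_of_exists {f g : A ⟶ B}
    (h : ∀ ⦃T : C⦄ (x : T ⟶ A.carrier), ∃ (T' : C) (e : T' ⟶ T) (_ : IsRegularEpi e)
      (y : T' ⟶ B.carrier), f.graph.Holds (e ≫ x) y ∧ g.graph.Holds (e ≫ x) y) : f = g := by
  refine Hom.ext (ext_holds fun T x y => ?_)
  obtain ⟨T', e, he, y', h₁, h₂⟩ := h x
  exact ⟨fun hf => (holds_of_rel_right g h₂ (rel_of_holds f h₁ (hf.precomp e))).descend e,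
    fun hg => (holds_of_rel_right f h₁ (rel_of_holds g h₂ (hg.precomp e))).descend e⟩

/-- A total relation contained in a single-valued one is equal to it, so only one inclusion is ever
checked. -/
theorem hom_ext_of_le {f g : A ⟶ B} (h : f.graph ≤ g.graph) : f = g :=
  hom_ext_of_exists fun T x => by
    obtain ⟨T', e, he, y, hy⟩ := exists_holds f x
    exact ⟨T', e, he, y, hy, le_iff_holds.1 h _ _ hy⟩

/-- A relation which is compatible with the equivalence relations, total and single-valued is a
morphism of the exact completion. -/
def homOfHolds (R : InternalRel A.carrier B.carrier)
    (left : ∀ ⦃T : C⦄ (x x' : T ⟶ A.carrier) (y : T ⟶ B.carrier),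
      A.rel.Holds x x' → R.Holds x' y → R.Holds x y)
    (right : ∀ ⦃T : C⦄ (x : T ⟶ A.carrier) (y y' : T ⟶ B.carrier),
      R.Holds x y → B.rel.Holds y y' → R.Holds x y')
    (total : ∀ ⦃T : C⦄ (x : T ⟶ A.carrier), ∃ (T' : C) (e : T' ⟶ T) (_ : IsRegularEpi e)
      (y : T' ⟶ B.carrier), R.Holds (e ≫ x) y)
    (unique : ∀ ⦃T : C⦄ (x : T ⟶ A.carrier) (y y' : T ⟶ B.carrier),
      R.Holds x y → R.Holds x y' → B.rel.Holds y y') : A ⟶ B where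
  graph := R
  rel_comp := by
    refine le_antisymm (le_iff_holds.2 fun T x y h => ?_) (le_iff_holds.2 fun T x y h => ?_)
    · obtain ⟨T', e, he, x', h₁, h₂⟩ := (holds_comp_iff _ _ _ _).1 h
      exact (left _ _ _ h₁ h₂).descend e
    · exact comp_holds (A.isEquivalence.holds_refl x) h
  comp_rel := by
    refine le_antisymm (le_iff_holds.2 fun T x y h => ?_) (le_iff_holds.2 fun T x y h => ?_)
    · obtain ⟨T', e, he, x', h₁, h₂⟩ := (holds_comp_iff _ _ _ _).1 h
      exact (right _ _ _ h₁ h₂).descend e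
    · exact comp_holds h (B.isEquivalence.holds_refl y)
  unit := le_iff_holds.2 fun T x x' h => by
    obtain ⟨T', e, he, y, hy⟩ := total x'
    exact (holds_comp_iff _ _ _ _).2
      ⟨T', e, he, y, left _ _ _ (h.precomp e) hy, (holds_opp_iff _ _ _).2 hy⟩
  counit := le_iff_holds.2 fun T y y' h => by
    obtain ⟨T', e, he, x, h₁, h₂⟩ := (holds_comp_iff _ _ _ _).1 h
    exact (unique _ _ _ ((holds_opp_iff _ _ _).1 h₁) h₂).descend e

/-- A morphism of underlying objects which preserves the equivalence relations induces a morphism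
of the exact completion. -/
noncomputable def homOfCarrier (φ : A.carrier ⟶ B.carrier)
    (hφ : ∀ ⦃T : C⦄ (x x' : T ⟶ A.carrier), A.rel.Holds x x' → B.rel.Holds (x ≫ φ) (x' ≫ φ)) :
    A ⟶ B :=
  homOfHolds (B.rel.inverseImage φ (𝟙 _))
    (fun T x x' y hx h => by
      rw [holds_inverseImage_iff] at h ⊢
      exact B.isEquivalence.holds_trans (hφ _ _ hx) h)
    (fun T x y y' h hy => by
      rw [holds_inverseImage_iff, Category.comp_id] at h ⊢
      exact B.isEquivalence.holds_trans h hy)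
    (fun T x => ⟨T, 𝟙 T, inferInstance, x ≫ φ, by
      rw [holds_inverseImage_iff, Category.id_comp, Category.comp_id]
      exact B.isEquivalence.holds_refl _⟩)
    (fun T x y y' h h' => by
      rw [holds_inverseImage_iff, Category.comp_id] at h h'
      exact B.isEquivalence.holds_trans (B.isEquivalence.holds_symm h) h')

theorem homOfCarrier_holds_iff (φ : A.carrier ⟶ B.carrier)
    (hφ : ∀ ⦃T : C⦄ (x x' : T ⟶ A.carrier), A.rel.Holds x x' → B.rel.Holds (x ≫ φ) (x' ≫ φ))
    (x : T ⟶ A.carrier) (y : T ⟶ B.carrier) :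
    (homOfCarrier φ hφ).graph.Holds x y ↔ B.rel.Holds (x ≫ φ) y := by
  change (B.rel.inverseImage φ (𝟙 _)).Holds x y ↔ _
  rw [holds_inverseImage_iff, Category.comp_id]

/-! ### Discrete objects as test objects. -/

/-- The object of the exact completion given by an object of `C` with the identity relation. -/
noncomputable abbrev discrete (T : C) : ExReg C := ⟨T, one T, isEquivalence_one T⟩

/-- The morphism from a discrete object given by a generalized element. -/
noncomputable def element (x : T ⟶ A.carrier) : discrete T ⟶ A :=
  homOfCarrier (A := discrete T) x fun W t t' h => by
    obtain rfl := (holds_one_iff _ _).1 h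
    exact A.isEquivalence.holds_refl _

theorem element_holds_iff (x : T ⟶ A.carrier) {W : C} (t : W ⟶ T) (y : W ⟶ A.carrier) :
    (element x).graph.Holds t y ↔ A.rel.Holds (t ≫ x) y :=
  homOfCarrier_holds_iff (A := discrete T) _ _ _ _

theorem element_comp_holds_iff (x : T ⟶ A.carrier) (f : A ⟶ B) {W : C} (t : W ⟶ T)
    (y : W ⟶ B.carrier) :
    (element x ≫ f).graph.Holds t y ↔ f.graph.Holds (t ≫ x) y := by
  have hx : (element x).graph.Holds t (t ≫ x) :=
    (element_holds_iff _ _ _).2 (A.isEquivalence.holds_refl _)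
  exact ⟨fun h => holds_right_of_comp _ _ h hx, fun h => holds_comp _ _ hx h⟩

/-- Turns a common value into an equation between morphisms, to which cancellation of monomorphisms
and the universal property of pullbacks apply. -/
theorem element_comp_eq {D : ExReg C} {x : T ⟶ A.carrier} {y : T ⟶ B.carrier} {f : A ⟶ D}
    {g : B ⟶ D} {z : T ⟶ D.carrier} (hf : f.graph.Holds x z) (hg : g.graph.Holds y z) :
    element x ≫ f = element y ≫ g :=
  hom_ext_of_exists fun W t => ⟨W, 𝟙 W, inferInstance, t ≫ z, by
    rw [Category.id_comp, element_comp_holds_iff, element_comp_holds_iff]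
    exact ⟨hf.precomp t, hg.precomp t⟩⟩

/-- Monomorphisms are injective on generalized elements. -/
theorem rel_of_mono (m : A ⟶ B) [Mono m] {x x' : T ⟶ A.carrier} {y : T ⟶ B.carrier}
    (h : m.graph.Holds x y) (h' : m.graph.Holds x' y) : A.rel.Holds x x' := by
  have e : element x = element x' := (cancel_mono m).1 (element_comp_eq h h')
  have hx : (element x').graph.Holds (𝟙 T) x' :=
    (element_holds_iff _ _ _).2 (by
      rw [Category.id_comp]
      exact A.isEquivalence.holds_refl x')
  rw [← e, element_holds_iff, Category.id_comp] at hx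
  exact hx

/-- Compatible elements of the factors of a pullback square come locally from its vertex. -/
theorem exists_holds_of_isPullback {P A B D : ExReg C} {u : P ⟶ A} {w : P ⟶ B} {f : A ⟶ D}
    {g : B ⟶ D} (h : IsPullback u w f g) {x : T ⟶ A.carrier} {y : T ⟶ B.carrier}
    {z : T ⟶ D.carrier} (hf : f.graph.Holds x z) (hg : g.graph.Holds y z) :
    ∃ (T' : C) (e : T' ⟶ T) (_ : IsRegularEpi e) (p : T' ⟶ P.carrier),
      u.graph.Holds p (e ≫ x) ∧ w.graph.Holds p (e ≫ y) := by
  have eq := element_comp_eq hf hg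
  -- The required element of `P` is a local value of the induced morphism at the generic element `𝟙
  -- T`.
  obtain ⟨T', e, he, p, hp⟩ := exists_holds (A := discrete T) (h.lift _ _ eq) (𝟙 T)
  have hp' : (h.lift _ _ eq).graph.Holds e p := by rwa [Category.comp_id] at hp
  refine ⟨T', e, he, p, holds_right_of_comp _ u ?_ hp', holds_right_of_comp _ w ?_ hp'⟩
  · rw [h.lift_fst, element_holds_iff]
    exact A.isEquivalence.holds_refl _
  · rw [h.lift_snd, element_holds_iff]
    exact B.isEquivalence.holds_refl _

/-! ### Pullbacks -/

section Pullback

variable (f : A ⟶ D) (g : B ⟶ D)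

/-- The relation of having the same image under `f` and `g`. -/
noncomputable def pullbackRel : InternalRel A.carrier B.carrier := f.graph.comp g.graph.opp

theorem pullbackRel_holds_iff (x : T ⟶ A.carrier) (y : T ⟶ B.carrier) :
    (pullbackRel f g).Holds x y ↔ ∃ (T' : C) (e : T' ⟶ T) (_ : IsRegularEpi e)
      (z : T' ⟶ D.carrier), f.graph.Holds (e ≫ x) z ∧ g.graph.Holds (e ≫ y) z := by
  simp only [pullbackRel, holds_comp_iff, holds_opp_iff]

/-- The vertex of the pullback square on `f` and `g`. -/
noncomputable abbrev pullbackObj : ExReg C where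
  -- The common image in `D` need not be recorded, being unique up to `D.rel`.
  carrier := (pullbackRel f g : C)
  rel := A.rel.inverseImage (pullbackRel f g).fst (pullbackRel f g).fst ⊓
    B.rel.inverseImage (pullbackRel f g).snd (pullbackRel f g).snd
  isEquivalence := (A.isEquivalence.inverseImage _).inf (B.isEquivalence.inverseImage _)

theorem pullbackObj_rel_holds_iff (p p' : T ⟶ (pullbackRel f g : C)) :
    (pullbackObj f g).rel.Holds p p' ↔
      A.rel.Holds (p ≫ (pullbackRel f g).fst) (p' ≫ (pullbackRel f g).fst) ∧
        B.rel.Holds (p ≫ (pullbackRel f g).snd) (p' ≫ (pullbackRel f g).snd) := by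
  rw [holds_inf_iff, holds_inverseImage_iff, holds_inverseImage_iff]

/-- The first projection of the pullback. -/
noncomputable def pullbackFst : pullbackObj f g ⟶ A :=
  homOfCarrier (A := pullbackObj f g) (pullbackRel f g).fst
    fun _ _ _ h => ((pullbackObj_rel_holds_iff f g _ _).1 h).1

/-- The second projection of the pullback. -/
noncomputable def pullbackSnd : pullbackObj f g ⟶ B :=
  homOfCarrier (A := pullbackObj f g) (pullbackRel f g).snd
    fun _ _ _ h => ((pullbackObj_rel_holds_iff f g _ _).1 h).2

theorem pullbackFst_holds_iff (p : T ⟶ (pullbackRel f g : C)) (x : T ⟶ A.carrier) :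
    (pullbackFst f g).graph.Holds p x ↔ A.rel.Holds (p ≫ (pullbackRel f g).fst) x :=
  homOfCarrier_holds_iff (A := pullbackObj f g) _ _ _ _

theorem pullbackSnd_holds_iff (p : T ⟶ (pullbackRel f g : C)) (y : T ⟶ B.carrier) :
    (pullbackSnd f g).graph.Holds p y ↔ B.rel.Holds (p ≫ (pullbackRel f g).snd) y :=
  homOfCarrier_holds_iff (A := pullbackObj f g) _ _ _ _

theorem pullbackFst_comp : pullbackFst f g ≫ f = pullbackSnd f g ≫ g := by
  refine hom_ext_of_exists fun T p => ?_
  obtain ⟨T', e, he, z, h₁, h₂⟩ := (pullbackRel_holds_iff f g _ _).1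
    ((pullbackRel f g).holds_legs.precomp p)
  exact ⟨T', e, he, z,
    holds_comp _ _ ((pullbackFst_holds_iff f g _ _).2 (by
      rw [Category.assoc]; exact A.isEquivalence.holds_refl _)) h₁,
    holds_comp _ _ ((pullbackSnd_holds_iff f g _ _).2 (by
      rw [Category.assoc]; exact B.isEquivalence.holds_refl _)) h₂⟩

variable {f g} {W : ExReg C}

theorem exists_pullbackObj_element {x : T ⟶ A.carrier} {y : T ⟶ B.carrier}
    {z : T ⟶ D.carrier} (hf : f.graph.Holds x z) (hg : g.graph.Holds y z) :
    ∃ p : T ⟶ (pullbackRel f g : C),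
      p ≫ (pullbackRel f g).fst = x ∧ p ≫ (pullbackRel f g).snd = y :=
  ((pullbackRel f g).holds_iff_exists _ _).1
    (comp_holds hf ((holds_opp_iff _ _ _).2 hg))

/-- The graph of the morphism into the pullback induced by `a` and `b`. -/
noncomputable def pullbackLiftGraph (a : W ⟶ A) (b : W ⟶ B) :
    InternalRel W.carrier (pullbackObj f g).carrier :=
  a.graph.inverseImage (𝟙 _) (pullbackRel f g).fst ⊓
    b.graph.inverseImage (𝟙 _) (pullbackRel f g).snd

theorem pullbackLiftGraph_holds_iff (a : W ⟶ A) (b : W ⟶ B) (w : T ⟶ W.carrier)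
    (p : T ⟶ (pullbackRel f g : C)) :
    (pullbackLiftGraph (f := f) (g := g) a b).Holds w p ↔
      a.graph.Holds w (p ≫ (pullbackRel f g).fst) ∧
        b.graph.Holds w (p ≫ (pullbackRel f g).snd) := by
  rw [pullbackLiftGraph, holds_inf_iff, holds_inverseImage_iff, holds_inverseImage_iff,
    Category.comp_id]

/-- The morphism into the pullback induced by a commutative square. -/
noncomputable def pullbackLift (a : W ⟶ A) (b : W ⟶ B) (h : a ≫ f = b ≫ g) :
    W ⟶ pullbackObj f g :=
  homOfHolds (pullbackLiftGraph a b)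
    (fun T w w' p hw hp => by
      rw [pullbackLiftGraph_holds_iff] at hp ⊢
      exact ⟨holds_of_rel_left a hw hp.1, holds_of_rel_left b hw hp.2⟩)
    (fun T w p p' hp hpp => by
      rw [pullbackLiftGraph_holds_iff] at hp ⊢
      rw [pullbackObj_rel_holds_iff] at hpp
      exact ⟨holds_of_rel_right a hp.1 hpp.1, holds_of_rel_right b hp.2 hpp.2⟩)
    (fun T w => by
      -- One value `z` of the common composite is factored through `a` and, on a further cover,
      -- through `b`; sharing `z` makes the two middle elements compatible.
      obtain ⟨T₁, e₁, he₁, z, hz⟩ := exists_holds (a ≫ f) w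
      have hz' := hz
      rw [h] at hz'
      obtain ⟨T₂, e₂, he₂, x, hx₁, hx₂⟩ := (holds_comp_iff _ _ _ _).1 hz
      obtain ⟨T₃, e₃, he₃, y, hy₁, hy₂⟩ := (holds_comp_iff _ _ _ _).1 (hz'.precomp e₂)
      obtain ⟨p, hp₁, hp₂⟩ := exists_pullbackObj_element (hx₂.precomp e₃) hy₂
      refine ⟨T₃, e₃ ≫ e₂ ≫ e₁, inferInstance, p, ?_⟩
      rw [pullbackLiftGraph_holds_iff, hp₁, hp₂]
      simp only [Category.assoc]
      exact ⟨hx₁.precomp e₃, hy₁⟩)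
    (fun T w p p' hp hp' => by
      rw [pullbackLiftGraph_holds_iff] at hp hp'
      rw [pullbackObj_rel_holds_iff]
      exact ⟨rel_of_holds a hp.1 hp'.1, rel_of_holds b hp.2 hp'.2⟩)

theorem pullbackLift_fst (a : W ⟶ A) (b : W ⟶ B) (h : a ≫ f = b ≫ g) :
    pullbackLift a b h ≫ pullbackFst f g = a :=
  hom_ext_of_le <| le_iff_holds.2 fun T w x hx => by
    obtain ⟨T', e, he, p, h₁, h₂⟩ := (holds_comp_iff _ _ _ _).1 hx
    exact (holds_of_rel_right a ((pullbackLiftGraph_holds_iff a b _ _).1 h₁).1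
      ((pullbackFst_holds_iff f g _ _).1 h₂)).descend e

theorem pullbackLift_snd (a : W ⟶ A) (b : W ⟶ B) (h : a ≫ f = b ≫ g) :
    pullbackLift a b h ≫ pullbackSnd f g = b :=
  hom_ext_of_le <| le_iff_holds.2 fun T w x hx => by
    obtain ⟨T', e, he, p, h₁, h₂⟩ := (holds_comp_iff _ _ _ _).1 hx
    exact (holds_of_rel_right b ((pullbackLiftGraph_holds_iff a b _ _).1 h₁).2
      ((pullbackSnd_holds_iff f g _ _).1 h₂)).descend e

/-- Elements of the vertex are identified exactly when both coordinates are, so the projections are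
jointly monic. -/
theorem pullbackObj_hom_ext {k l : W ⟶ pullbackObj f g}
    (h₁ : k ≫ pullbackFst f g = l ≫ pullbackFst f g)
    (h₂ : k ≫ pullbackSnd f g = l ≫ pullbackSnd f g) : k = l := by
  refine hom_ext_of_exists fun T w => ?_
  obtain ⟨T₁, e₁, he₁, p, hp⟩ := exists_holds k w
  obtain ⟨T₂, e₂, he₂, q, hq⟩ := exists_holds l (e₁ ≫ w)
  have hp' := hp.precomp e₂
  have hpq : (pullbackObj f g).rel.Holds q (e₂ ≫ p) := by
    rw [pullbackObj_rel_holds_iff, ← pullbackFst_holds_iff, ← pullbackSnd_holds_iff]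
    refine ⟨holds_right_of_comp l _ ?_ hq, holds_right_of_comp l _ ?_ hq⟩
    · rw [← h₁]
      exact holds_comp k _ hp' ((pullbackFst_holds_iff f g _ _).2 (A.isEquivalence.holds_refl _))
    · rw [← h₂]
      exact holds_comp k _ hp' ((pullbackSnd_holds_iff f g _ _).2 (B.isEquivalence.holds_refl _))
  refine ⟨T₂, e₂ ≫ e₁, inferInstance, e₂ ≫ p, ?_⟩
  rw [Category.assoc]
  exact ⟨hp', holds_of_rel_right l hq hpq⟩

variable (f g) in
theorem isPullback_pullbackObj : IsPullback (pullbackFst f g) (pullbackSnd f g) f g :=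
  ⟨⟨pullbackFst_comp f g⟩, ⟨PullbackCone.IsLimit.mk _ (fun s => pullbackLift s.fst s.snd s.condition)
    (fun _ => pullbackLift_fst _ _ _) (fun _ => pullbackLift_snd _ _ _)
    (fun _ _ h₁ h₂ => pullbackObj_hom_ext (h₁.trans (pullbackLift_fst _ _ _).symm)
      (h₂.trans (pullbackLift_snd _ _ _).symm))⟩⟩

end Pullback

instance hasPullbacks : HasPullbacks (ExReg C) :=
  have (A B D : ExReg C) (f : A ⟶ D) (g : B ⟶ D) : HasLimit (cospan f g) :=
    (isPullback_pullbackObj f g).hasPullback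
  hasPullbacks_of_hasLimit_cospan _

/-! ### Protomodularity -/

/-- If `C` is protomodular, then in a pullback square with `p` a split epimorphism, a subobject
containing the values of `g` and of the section `s` is everything. -/
theorem factors_of_protomodular (hC : Protomodular C) {D E A B : ExReg C} {g : D ⟶ E} {q : D ⟶ A}
    {p : E ⟶ B} {f : A ⟶ B} {s : B ⟶ E} (h : IsPullback g q p f) (hs : s ≫ p = 𝟙 B)
    (N : Subobject E.carrier)
    (hg : ∀ ⦃T : C⦄ (d : T ⟶ D.carrier) (y : T ⟶ E.carrier), g.graph.Holds d y → N.Factors y)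
    (hsN : ∀ ⦃T : C⦄ (b : T ⟶ B.carrier) (y : T ⟶ E.carrier), s.graph.Holds b y → N.Factors y)
    (y : T ⟶ E.carrier) : N.Factors y := by
  -- If `s` sends `b` to `y`, then `p` sends `y` to `b`; hence the graph of `s` maps to that of `p`
  -- by `σ`, which gives the section `s'` below.
  have hsp : p.graph.Holds s.graph.snd s.graph.fst := by
    refine holds_right_of_comp s p ?_ s.graph.holds_legs
    rw [hs, id_graph]
    exact B.isEquivalence.holds_refl _
  obtain ⟨σ, hσ₁, hσ₂⟩ := (p.graph.holds_iff_exists _ _).1 hsp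
  -- The square in `C` lies over the graph of `s`, and its fibre products use strict equality in the
  -- carrier of `B`. The map `r` reads off the element of `E`.
  let r : pullback p.graph.snd s.graph.fst ⟶ E.carrier := pullback.fst _ _ ≫ p.graph.fst
  let p' := pullback.snd p.graph.snd s.graph.fst
  let f' := pullback.snd f.graph.snd s.graph.fst
  let s' : (s.graph : C) ⟶ pullback p.graph.snd s.graph.fst :=
    pullback.lift σ (𝟙 _) (by rw [hσ₂, Category.id_comp])
  have hs' : s' ≫ p' = 𝟙 _ := pullback.lift_snd _ _ _
  have hsr : s' ≫ r = s.graph.snd := by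
    rw [← hσ₁, ← Category.assoc, pullback.lift_fst]
  have hNs : N.Factors (s' ≫ r) := by
    rw [hsr]
    exact hsN _ _ s.graph.holds_legs
  -- An element of this pullback gives elements of `E` and `A` with the same image in `B`, so
  -- locally the former is a value of `g`.
  have hNg : N.Factors (pullback.fst p' f' ≫ r) := by
    have h₁ := (p.graph.holds_legs.precomp (pullback.fst _ s.graph.fst)).precomp
      (pullback.fst p' f')
    have h₂ := (f.graph.holds_legs.precomp (pullback.fst _ s.graph.fst)).precomp
      (pullback.snd p' f')
    have e : pullback.fst p' f' ≫ pullback.fst p.graph.snd s.graph.fst ≫ p.graph.snd =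
        pullback.snd p' f' ≫ pullback.fst f.graph.snd s.graph.fst ≫ f.graph.snd := by
      rw [pullback.condition, pullback.condition, ← Category.assoc, ← Category.assoc,
        pullback.condition]
    rw [e] at h₁
    obtain ⟨T', e', he', d, hd, -⟩ := exists_holds_of_isPullback h h₁ h₂
    exact N.factors_of_regularEpi_comp e' (hg _ _ hd)
  -- The inverse image of `N` along `r` contains both legs of a jointly strongly epimorphic pair;
  -- lifting the identity through it shows that it is everything.
  have hr : N.Factors r := by
    obtain ⟨d, hd⟩ := (hC.jointlyStrongEpi _ _ _ _ s' (IsPullback.of_hasPullback p' f')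
      hs').exists_lift (pullback.snd N.arrow r)
      (pullback.lift (N.factorThru _ hNg) (pullback.fst p' f') (Subobject.factorThru_arrow _ _ _))
      (pullback.lift (N.factorThru _ hNs) s' (Subobject.factorThru_arrow _ _ _)) (𝟙 _)
      (by rw [pullback.lift_snd, Category.comp_id]) (by rw [pullback.lift_snd, Category.comp_id])
    refine (Subobject.factors_iff _ _).2 ⟨d ≫ pullback.fst N.arrow r, ?_⟩
    change (d ≫ pullback.fst N.arrow r) ≫ N.arrow = r
    rw [Category.assoc, pullback.condition, ← Category.assoc, hd, Category.id_comp]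
  -- Totality of `p` and `s` shows that every `y` lifts locally along `r`.
  obtain ⟨T₁, e₁, he₁, b, hb⟩ := exists_holds p y
  obtain ⟨T₂, e₂, he₂, y₀, hy₀⟩ := exists_holds s b
  obtain ⟨k, hk₁, hk₂⟩ := (p.graph.holds_iff_exists _ _).1 (hb.precomp e₂)
  obtain ⟨l, hl₁, hl₂⟩ := (s.graph.holds_iff_exists _ _).1 hy₀
  apply N.factors_of_regularEpi_comp e₁
  apply N.factors_of_regularEpi_comp e₂
  have e : e₂ ≫ e₁ ≫ y = pullback.lift k l (hk₂.trans hl₁.symm) ≫ r := by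
    rw [← hk₁, ← Category.assoc, pullback.lift_fst]
  rw [e]
  exact Subobject.factors_of_factors_right _ hr

theorem jointlyStrongEpi_of_protomodular (hC : Protomodular C) {D E A B : ExReg C} {g : D ⟶ E}
    {q : D ⟶ A} {p : E ⟶ B} {f : A ⟶ B} {s : B ⟶ E} (h : IsPullback g q p f) (hs : s ≫ p = 𝟙 B) :
    JointlyStrongEpi g s where
  hom_ext V k l hgk hsk := by
    -- The domain of `k.graph ⊓ l.graph` is the locus where `k` and `l` agree.
    have key : ∀ {Z : ExReg C} (t : Z ⟶ E), t ≫ k = t ≫ l → ∀ ⦃T : C⦄ (z : T ⟶ Z.carrier)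
        (y : T ⟶ E.carrier), t.graph.Holds z y → (k.graph ⊓ l.graph).dom.Factors y := by
      intro Z t e T z y hy
      obtain ⟨T', e', he', v, hv⟩ := exists_holds k y
      refine Subobject.factors_of_regularEpi_comp _ e' (dom_factors_of_holds
        ((holds_inf_iff _ _ _ _).2 ⟨hv, holds_right_of_comp t l ?_ (hy.precomp e')⟩))
      rw [← e]
      exact holds_comp t k (hy.precomp e') hv
    refine hom_ext_of_exists fun T y => ?_
    obtain ⟨T', e, he, v, hv⟩ := exists_holds_of_dom_factors
      (factors_of_protomodular hC h hs _ (key g hgk) (key s hsk) y)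
    exact ⟨T', e, he, v, (holds_inf_iff _ _ _ _).1 hv⟩
  exists_lift U V m _ a b k ha hb := by
    -- The domain of `pullbackRel k m` consists of the `y` for which `k y` is locally a value of
    -- `m`. Once it is everything, that relation is total and its graph serves as the lift.
    have key : ∀ {Z : ExReg C} (t : Z ⟶ E) (c : Z ⟶ U), c ≫ m = t ≫ k → ∀ ⦃T : C⦄
        (z : T ⟶ Z.carrier) (y : T ⟶ E.carrier), t.graph.Holds z y →
        (pullbackRel k m).dom.Factors y := by
      intro Z t c e T z y hy
      obtain ⟨T₁, e₁, he₁, w, hw⟩ := exists_holds c z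
      obtain ⟨T₂, e₂, he₂, v, hv⟩ := exists_holds m w
      apply Subobject.factors_of_regularEpi_comp _ e₁
      apply Subobject.factors_of_regularEpi_comp _ e₂
      have hz := holds_comp c m (hw.precomp e₂) hv
      rw [e] at hz
      exact dom_factors_of_holds (comp_holds
        (holds_right_of_comp t k hz ((hy.precomp e₁).precomp e₂)) ((holds_opp_iff _ _ _).2 hv))
    refine ⟨homOfHolds (pullbackRel k m) ?_ ?_ ?_ ?_, hom_ext_of_le (le_iff_holds.2 ?_)⟩
    · intro T y y' u hy hu
      rw [pullbackRel_holds_iff] at hu ⊢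
      obtain ⟨T', e, he, v, hk, hm⟩ := hu
      exact ⟨T', e, he, v, holds_of_rel_left k (hy.precomp e) hk, hm⟩
    · intro T y u u' hu huu
      rw [pullbackRel_holds_iff] at hu ⊢
      obtain ⟨T', e, he, v, hk, hm⟩ := hu
      exact ⟨T', e, he, v, hk,
        holds_of_rel_left m (U.isEquivalence.holds_symm (huu.precomp e)) hm⟩
    · intro T y
      exact exists_holds_of_dom_factors
        (factors_of_protomodular hC h hs _ (key g a ha) (key s b hb) y)
    · intro T y u u' hu hu'
      rw [pullbackRel_holds_iff] at hu hu'
      obtain ⟨T₁, e₁, he₁, v, hk, hm⟩ := hu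
      obtain ⟨T₂, e₂, he₂, v', hk', hm'⟩ := hu'
      -- On a common refinement of the two covers, `v` and `v'` are both values of `k` at `y`, hence
      -- related; injectivity of `m` then relates `u` and `u'`.
      apply Holds.descend (pullback.snd e₁ e₂ ≫ e₂)
      have e : pullback.fst e₁ e₂ ≫ e₁ = pullback.snd e₁ e₂ ≫ e₂ := pullback.condition
      have hk₁ := hk.precomp (pullback.fst e₁ e₂)
      have hk₂ := hk'.precomp (pullback.snd e₁ e₂)
      have hm₁ := hm.precomp (pullback.fst e₁ e₂)
      have hm₂ := hm'.precomp (pullback.snd e₁ e₂)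
      rw [← Category.assoc] at hk₁ hk₂ hm₁ hm₂
      rw [e] at hk₁ hm₁
      exact rel_of_mono m (holds_of_rel_right m hm₁ (rel_of_holds k hk₁ hk₂)) hm₂
    · intro T y v hv
      obtain ⟨T₁, e₁, he₁, u, hu, hm⟩ := (holds_comp_iff _ _ _ _).1 hv
      obtain ⟨T₂, e₂, he₂, v', hk', hm'⟩ := (pullbackRel_holds_iff k m _ _).1 hu
      apply Holds.descend e₁
      apply Holds.descend e₂
      exact holds_of_rel_right k hk' (rel_of_holds m hm' (hm.precomp e₂))

end ExReg

/-- If `C` is a regular protomodular category, then its exact completion (as a regular category) is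
also protomodular. -/
theorem mainTheorem3 {C : Type u} [Category.{v} C] [Regular C] (hC : Protomodular C) :
    Protomodular (ExReg C) where
  hasPullbacks := ExReg.hasPullbacks
  jointlyStrongEpi _ _ _ _ _ _ _ _ _ h hs := ExReg.jointlyStrongEpi_of_protomodular hC h hs
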